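/- Let $m\ge 0$, let $(a_j)_{j\ge 0}$ be complex numbers with $a_0=1$, and let $\rho=\sum_{n\ge 1}\frac{b_n}{n!}\phi^n$ be the compositional inverse of the formal diffeomorphism $\phi=\sum_{j\ge 0}a_j\rho^{j+1}$. For a momentum $p$ in a Minkowski space of any dimension $\geq 1$, with square $p^2=p_0^2-p_1^2-p_2^2-\dots$, put $x_p:=p^2-m^2$ and call $p$ onshell if $x_p=0$. Let $B_{n,k}$ be the partial Bell polynomials and, for $n\ge 3$, let $$f_n=B_{n-2,1}(2!a_1,3!a_2,\ldots)+B_{n-2,2}(2!a_1,3!a_2,\ldots),\qquad g_n=n f_n-B_{n,2}(1!a_0,2!a_1,3!a_2,\ldots).$$ Consider the Feynman rules obtained from the free Lagrangian $\frac12\partial_\mu\phi\,\partial^\mu\phi-\frac12m^2\phi^2$ by inserting $\phi=\phi(\rho)$: an $n$-valent vertex ($n\ge 3$) whose adjacent edges have offshell variables $x_1,\dots,x_n$ contributes $i f_n(x_1+\dots+x_n)+i g_n m^2$, and an internal edge with momentum $q$ contributes the propagator $\frac{i}{x_q}$. Then $b_1=1$. Let moreover $n\ge 2$ and let $p_1,\dots,p_n$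 be onshell momenta such that $x_S:=x_{\sum_{j\in S}p_j}\neq 0$ for all $S\subsetneq\{1,\dots,n\}$ with $|S|\ge 2$ (so that no internal propagator is singular). Let $A^1_{n+1}$ be the amputated tree sum with $n+1$ external edges, at most one of which is offshell, that is, the sum of the Feynman amplitudes, without propagators for external edges, of all trees with $n+1$ labelled external edges and all vertices of valence at least $3$, where $n$ external edges carry the momenta $p_1,\dots,p_n$ and the remaining one carries $p=p_1+\dots+p_n$, which need not be onshell. Then $$A^1_{n+1}=-i\,x_p\,b_n .$$ In particular, if $x_p\ne 0$, the tree sum that includes the propagator of the offshell edge is the coefficient of the inverse diffeomorphism: $\frac{i}{x_p}A^1_{n+1}=b_n$, independently of the mass and the momenta. -/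

import Mathlib

namespace FieldDiffeo

noncomputable section

/-! ### Kinematics -/

/-- Momenta in `d + 1` space-time dimensions; component `0` is the energy. -/
abbrev Momentum (d : ℕ) : Type := Fin (d + 1) → ℝ

/-- The Minkowski square `p² = p₀² - p₁² - ⋯ - p_d²`. -/
def minkowskiSq {d : ℕ} (p : Momentum d) : ℝ :=
  p 0 ^ 2 - ∑ i : Fin d, p i.succ ^ 2

/-- The offshell variable `x_p = p² - m²`; the momentum `p` is onshell iff it vanishes. -/
def offshell {d : ℕ} (m : ℝ) (p : Momentum d) : ℝ :=
  minkowskiSq p - m ^ 2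

/-! ### The diffeomorphism and its inverse -/

/-- The formal diffeomorphism `φ(ρ) = ∑_{j ≥ 0} a_j ρ^{j+1}`. -/
def diffeo (a : ℕ → ℂ) : PowerSeries ℂ :=
  PowerSeries.mk fun n => if n = 0 then 0 else a (n - 1)

/-- The formal power series `∑_{n ≥ 0} (b_n / n!) φ^n`. -/
def expSeries (b : ℕ → ℂ) : PowerSeries ℂ :=
  PowerSeries.mk fun n => b n / (n.factorial : ℂ)

/-- `ρ(φ) = ∑_{n ≥ 1} (b_n / n!) φ^n` is the compositional inverse of `φ(ρ) = ∑ a_j ρ^{j+1}`.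
(`PowerSeries.subst g f` is `f(g(X))`.) -/
structure IsInverseDiffeo (a b : ℕ → ℂ) : Prop where
  zero : b 0 = 0
  left_inv : PowerSeries.subst (diffeo a) (expSeries b) = PowerSeries.X
  right_inv : PowerSeries.subst (expSeries b) (diffeo a) = PowerSeries.X

/-! ### Feynman rules of the transformed free field -/

/-- The partial Bell polynomial `B_{n,k}(x₁, x₂, …)`: the coefficient of `u^k t^n / n!` in
`exp (u ∑_{j ≥ 1} x_j t^j / j!)`, that is, `n! / k!` times the coefficient of `t^n` in
`(∑_{j ≥ 1} x_j t^j / j!)^k`. The value `x 0` is not used. -/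
def bell (n k : ℕ) (x : ℕ → ℂ) : ℂ :=
  (n.factorial : ℂ) / (k.factorial : ℂ) *
    PowerSeries.coeff n
      ((PowerSeries.mk fun j => if j = 0 then 0 else x j / (j.factorial : ℂ)) ^ k)

/-- `f_n = B_{n-2,1}(2! a₁, 3! a₂, …) + B_{n-2,2}(2! a₁, 3! a₂, …)`, used for `n ≥ 3`. -/
def fCoeff (a : ℕ → ℂ) (n : ℕ) : ℂ :=
  bell (n - 2) 1 (fun j => ((j + 1).factorial : ℂ) * a j) +
    bell (n - 2) 2 (fun j => ((j + 1).factorial : ℂ) * a j)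

/-- `c_{n-2} = B_{n,2}(1! a₀, 2! a₁, 3! a₂, …)`, indexed here by the valence `n`. -/
def cCoeff (a : ℕ → ℂ) (n : ℕ) : ℂ :=
  bell n 2 (fun j => (j.factorial : ℂ) * a (j - 1))

/-- `g_n = n f_n - c_{n-2}`. -/
def gCoeff (a : ℕ → ℂ) (n : ℕ) : ℂ :=
  (n : ℂ) * fCoeff a n - cCoeff a n

/-- The Feynman rule `i v_n = i f_n (x₁ + ⋯ + x_n) + i g_n m²` of the `n`-valent vertex, where
`s = x₁ + ⋯ + x_n` is the sum of the offshell variables of the adjacent edges. -/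
def vertexRule (m : ℝ) (a : ℕ → ℂ) (n : ℕ) (s : ℝ) : ℂ :=
  Complex.I * fCoeff a n * (s : ℂ) + Complex.I * gCoeff a n * (m : ℂ) ^ 2

/-- The propagator `i / x` of an edge with offshell variable `x`. -/
def propagator (x : ℝ) : ℂ :=
  Complex.I / (x : ℂ)

/-! ### Feynman trees

Consider a tree all of whose vertices have valence at least three, with `n + 1` labelled external
edges: the external edges `j : Fin n` and one further, distinguished, external edge. Cutting an
edge `e` separates the distinguished external edge from a nonempty set `S_e ⊆ Fin n` of the
others. The tree is determined by the family `T` of all these sets, and the families that arise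
are the hierarchies on `Fin n`:
* the edges of the tree are the members of `T`; the singleton `{j}` is the external edge `j`, the
  whole of `Fin n` is the distinguished external edge, and all other members are internal edges;
* the vertices of the tree are the members `S` of `T` with at least two elements, `S` standing for
  the endpoint of the edge `S` that is farther from the distinguished external edge; the edges at
  this vertex are `S` itself and the maximal members of `T` strictly contained in `S`.
-/

end

/-- The trees with external edges `j : Fin n` and one distinguished external edge, each listed
exactly once. -/
def feynmanTrees (n : ℕ) : Finset (Finset (Finset (Fin n))) :=
  Finset.univ.filter fun T =>
    ∅ ∉ T ∧ Finset.univ ∈ T ∧ (∀ j, {j} ∈ T) ∧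
      ∀ S ∈ T, ∀ S' ∈ T, S ⊆ S' ∨ S' ⊆ S ∨ Disjoint S S'

/-- The vertices of a tree. -/
def treeVertices {n : ℕ} (T : Finset (Finset (Fin n))) : Finset (Finset (Fin n)) :=
  T.filter fun S => 2 ≤ S.card

/-- The internal edges of a tree. -/
def internalEdges {n : ℕ} (T : Finset (Finset (Fin n))) : Finset (Finset (Fin n)) :=
  T.filter fun S => 2 ≤ S.card ∧ S ≠ Finset.univ

/-- The edges that meet the vertex `S` of a tree. -/
def edgesAt {n : ℕ} (T : Finset (Finset (Fin n))) (S : Finset (Fin n)) :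
    Finset (Finset (Fin n)) :=
  insert S (T.filter fun C => C ⊂ S ∧ ∀ C' ∈ T, C ⊂ C' → ¬ C' ⊂ S)

noncomputable section

/-- The offshell variable of the edge `S`. By momentum conservation at the vertices, the momentum
that flows through it is the sum of the external momenta `p j` with `j ∈ S`. In particular the
distinguished external edge `S = Finset.univ` carries the sum of all `p j`. -/
def edgeVar {d n : ℕ} (m : ℝ) (p : Fin n → Momentum d) (S : Finset (Fin n)) : ℝ :=
  offshell m (∑ j ∈ S, p j)

/-- The Feynman amplitude of a tree: a vertex rule for each vertex and a propagator for each
internal edge, none for the external edges. -/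
def treeAmplitude {d n : ℕ} (m : ℝ) (a : ℕ → ℂ) (p : Fin n → Momentum d)
    (T : Finset (Finset (Fin n))) : ℂ :=
  (∏ S ∈ treeVertices T,
      vertexRule m a (edgesAt T S).card (∑ C ∈ edgesAt T S, edgeVar m p C)) *
    ∏ S ∈ internalEdges T, propagator (edgeVar m p S)

/-- The amputated tree sum with `n + 1` external edges. At onshell momenta `p j` it is the
amplitude `A¹_{n+1}` of the meta-vertex whose offshell edge is the distinguished one. -/
def amputatedTreeSum {d n : ℕ} (m : ℝ) (a : ℕ → ℂ) (p : Fin n → Momentum d) : ℂ :=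
  ∑ T ∈ feynmanTrees n, treeAmplitude m a p T

/-- The tree sum that includes the propagator of the distinguished external edge. -/
def treeSum {d n : ℕ} (m : ℝ) (a : ℕ → ℂ) (p : Fin n → Momentum d) : ℂ :=
  propagator (edgeVar m p Finset.univ) * amputatedTreeSum m a p

end

end FieldDiffeo

namespace FieldDiffeo

/-! ### Forests and their decompositions -/

section Forests

/-! Induct on the set `S` of onshell legs: trees on `S`, weighted with vertices and with propagators
on the edges above them, sum to `b |S|` (`sum_trees_forestWeight`). Removing the top vertex of a
tree leaves a forest with at least two roots, so by induction the roots contribute factors `b |R|`,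
and the amputated sum (`sum_amputated`) is a sum over forests of the top vertex rule.

Write x_R = y_R - m², where y_R = ∑_{i,j ∈ R} p_i·p_j is a quadratic form with diagonal m². At a
vertex with k children, g_{k+1} = (k+1) f_{k+1} - c_{k+1} cancels the m² from the offshell
variables, leaving i (f_{k+1} (y_S + ∑ y_C) - m² c_{k+1}), with c_n = `cCoeff a n`.

A forest sum weighted by h(number of roots) is a coefficient of H∘ρ, with H the exponential
generating function of h (`forestSum_eq_egfCoeff_subst`). Let F and L be the series of f_{k+1} and
of c_{k+1} without k = 1, and let Φ and Λ be the n-th exponential coefficients of F∘ρ and L∘ρ, with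
n = |S|. In the sum over roots, p_i·p_j gets the coefficient of the pairs lying in a common root: Φ
if i = j, and that of ρ''·(F'∘ρ) in degree n - 2 otherwise.

From 2F' = φ'² - 1, L = φφ' - t and φ'(ρ) ρ' = 1 follow two identities. `offshell_identity` says
that Φ plus the off-diagonal coefficient is -b_n; `onshell_identity` says that n (2Φ + b_n) = Λ +
b_n. The first turns all i ≠ j terms into -b_n p_i·p_j, and the second disposes of the diagonal and
mass terms. What remains is -i b_n (y_S - m²) = -i b_n x_S, and the propagator i/x_S makes it b_n.
-/

theorem not_subset_of_disjoint {β : Type*} {A B : Finset β} (hA : A.Nonempty) (h : Disjoint A B) :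
    ¬ A ⊆ B := fun hs => by
  obtain ⟨x, hx⟩ := hA
  exact Finset.disjoint_left.1 h hx (hs hx)

variable {α : Type*} [DecidableEq α]

/-- The laminar families of nonempty subsets of `S` that contain all singletons. -/
def forests (S : Finset α) : Finset (Finset (Finset α)) :=
  S.powerset.powerset.filter fun F =>
    ∅ ∉ F ∧ (∀ j ∈ S, {j} ∈ F) ∧ ∀ A ∈ F, ∀ B ∈ F, A ⊆ B ∨ B ⊆ A ∨ Disjoint A B

/-- The forests on `S` that have `S` as a member. -/
def trees (S : Finset α) : Finset (Finset (Finset α)) :=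
  (forests S).filter fun F => S ∈ F

/-- The maximal members of a family. -/
def roots (F : Finset (Finset α)) : Finset (Finset α) :=
  F.filter fun A => ∀ B ∈ F, ¬ A ⊂ B

/-- The maximal members of `F` strictly contained in `S`. -/
def children (F : Finset (Finset α)) (S : Finset α) : Finset (Finset α) :=
  F.filter fun C => C ⊂ S ∧ ∀ C' ∈ F, C ⊂ C' → ¬ C' ⊂ S

/-- The product over all vertices of a forest of a factor depending on the vertex and its
children. -/
def forestWeight (v : Finset α → Finset (Finset α) → ℂ) (F : Finset (Finset α)) : ℂ :=
  ∏ S ∈ F.filter fun S => 2 ≤ S.card, v S (children F S)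

theorem mem_forests {S : Finset α} {F : Finset (Finset α)} :
    F ∈ forests S ↔ (∀ A ∈ F, A ⊆ S) ∧ ∅ ∉ F ∧ (∀ j ∈ S, {j} ∈ F) ∧
      ∀ A ∈ F, ∀ B ∈ F, A ⊆ B ∨ B ⊆ A ∨ Disjoint A B := by
  simp only [forests, Finset.mem_filter, Finset.mem_powerset]
  refine and_congr_left fun _ => ?_
  simp [Finset.subset_iff (s₁ := F)]

theorem mem_trees {S : Finset α} {F : Finset (Finset α)} :
    F ∈ trees S ↔ F ∈ forests S ∧ S ∈ F := by
  simp [trees]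

theorem nonempty_of_mem_forest {S A : Finset α} {F : Finset (Finset α)} (hF : F ∈ forests S)
    (hA : A ∈ F) : A.Nonempty :=
  Finset.nonempty_iff_ne_empty.2 fun h => (mem_forests.1 hF).2.1 (h ▸ hA)

theorem exists_mem_roots_superset {F : Finset (Finset α)} {A : Finset α} (hA : A ∈ F) :
    ∃ R ∈ roots F, A ⊆ R := by
  obtain ⟨R, hAR, hR⟩ := F.exists_le_maximal hA
  refine ⟨R, Finset.mem_filter.2 ⟨hR.1, fun B hB hRB => ?_⟩, hAR⟩
  exact hRB.2 (hR.2 hB hRB.1)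

theorem subset_or_disjoint_of_mem_roots {S A R : Finset α} {F : Finset (Finset α)}
    (hF : F ∈ forests S) (hR : R ∈ roots F) (hA : A ∈ F) : A ⊆ R ∨ Disjoint A R := by
  have hR' := Finset.mem_filter.1 hR
  rcases (mem_forests.1 hF).2.2.2 A hA R hR'.1 with h | h | h
  · exact .inl h
  · by_cases hs : A ⊆ R
    · exact .inl hs
    · exact absurd ⟨h, hs⟩ (hR'.2 A hA)
  · exact .inr h

theorem existsUnique_mem_roots {S : Finset α} {F : Finset (Finset α)} (hF : F ∈ forests S)
    {j : α} (hj : j ∈ S) : ∃! R, R ∈ roots F ∧ j ∈ R := by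
  obtain ⟨R, hR, hjR⟩ := exists_mem_roots_superset ((mem_forests.1 hF).2.2.1 j hj)
  have hjR : j ∈ R := Finset.singleton_subset_iff.1 hjR
  refine ⟨R, ⟨hR, hjR⟩, fun R' ⟨hR', hj'⟩ => ?_⟩
  have hd : ¬ Disjoint R' R := Finset.not_disjoint_iff.2 ⟨j, hj', hjR⟩
  have h1 := (subset_or_disjoint_of_mem_roots hF hR (Finset.mem_filter.1 hR').1).resolve_right hd
  have h2 := (subset_or_disjoint_of_mem_roots hF hR' (Finset.mem_filter.1 hR).1).resolve_right
    (fun h => hd h.symm)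
  exact h1.antisymm h2

theorem roots_eq_singleton_of_mem {S : Finset α} {F : Finset (Finset α)} (hF : F ∈ forests S)
    (hS : S ∈ F) : roots F = {S} := by
  have hsub := (mem_forests.1 hF).1
  ext A
  simp only [roots, Finset.mem_filter, Finset.mem_singleton]
  constructor
  · rintro ⟨hA, hmax⟩
    by_contra hne
    exact hmax S hS ((hsub A hA).ssubset_of_ne hne)
  · rintro rfl
    exact ⟨hS, fun B hB h => h.2 (hsub B hB)⟩

/-- This turns the condition `S ∉ F` into one on the number of roots, so that a weight `h` with `h 1
= 0` discards exactly the forests that are trees. -/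
theorem card_roots_eq_one_iff {S : Finset α} {F : Finset (Finset α)} (hF : F ∈ forests S) :
    (roots F).card = 1 ↔ S ∈ F := by
  refine ⟨fun h => ?_, fun h => by simp [roots_eq_singleton_of_mem hF h]⟩
  obtain ⟨R, hR⟩ := Finset.card_eq_one.1 h
  have hRF : R ∈ F := (Finset.mem_filter.1 (hR ▸ Finset.mem_singleton_self R : R ∈ roots F)).1
  have : R = S := by
    refine ((mem_forests.1 hF).1 R hRF).antisymm fun j hj => ?_
    obtain ⟨R', ⟨hR', hj'⟩, -⟩ := existsUnique_mem_roots hF hj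
    rw [hR, Finset.mem_singleton] at hR'
    exact hR' ▸ hj'
  exact this ▸ hRF

theorem forests_empty : forests (∅ : Finset α) = {∅} := by
  ext F
  rw [mem_forests, Finset.mem_singleton]
  constructor
  · rintro ⟨h1, h2, -⟩
    refine Finset.eq_empty_of_forall_notMem fun A hA => h2 ?_
    rwa [Finset.subset_empty.1 (h1 A hA)] at hA
  · rintro rfl
    simp

theorem trees_singleton (j : α) : trees ({j} : Finset α) = {{{j}}} := by
  ext F
  rw [mem_trees, mem_forests, Finset.mem_singleton]
  constructor
  · rintro ⟨⟨h1, h2, -⟩, h3⟩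
    ext A
    rw [Finset.mem_singleton]
    refine ⟨fun hA => (Finset.subset_singleton_iff.1 (h1 A hA)).resolve_left ?_, fun h => h ▸ h3⟩
    rintro rfl
    exact h2 hA
  · rintro rfl
    simp

/-! #### Adding or removing the top of a tree -/

theorem insert_mem_trees {S : Finset α} {F : Finset (Finset α)} (hF : F ∈ forests S)
    (hne : S.Nonempty) : insert S F ∈ trees S := by
  obtain ⟨h1, h2, h3, h4⟩ := mem_forests.1 hF
  refine mem_trees.2 ⟨mem_forests.2 ⟨?_, ?_, ?_, ?_⟩, Finset.mem_insert_self _ _⟩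
  · simpa using h1
  · simpa [h2] using hne.ne_empty.symm
  · exact fun j hj => Finset.mem_insert_of_mem (h3 j hj)
  · intro A hA B hB
    rw [Finset.mem_insert] at hA hB
    rcases hA with rfl | hA <;> rcases hB with rfl | hB
    · exact .inl subset_rfl
    · exact .inr (.inl (h1 B hB))
    · exact .inl (h1 A hA)
    · exact h4 A hA B hB

theorem erase_mem_forests {S : Finset α} {F : Finset (Finset α)} (hF : F ∈ forests S)
    (hS : 2 ≤ S.card) : F.erase S ∈ forests S := by
  obtain ⟨h1, h2, h3, h4⟩ := mem_forests.1 hF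
  refine mem_forests.2 ⟨?_, ?_, ?_, ?_⟩
  · exact fun A hA => h1 A (Finset.mem_of_mem_erase hA)
  · exact fun h => h2 (Finset.mem_of_mem_erase h)
  · refine fun j hj => Finset.mem_erase.2 ⟨?_, h3 j hj⟩
    rintro rfl
    simp at hS
  · exact fun A hA B hB => h4 A (Finset.mem_of_mem_erase hA) B (Finset.mem_of_mem_erase hB)

/-- Erasing the top `S` is a bijection; `S` is not a singleton, so the remaining family still
contains all singletons. -/
theorem sum_trees_eq {S : Finset α} (hS : 2 ≤ S.card) (g : Finset (Finset α) → ℂ) :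
    ∑ T ∈ trees S, g T = ∑ F ∈ (forests S).filter (fun F => S ∉ F), g (insert S F) := by
  refine Finset.sum_nbij' (fun T => T.erase S) (fun F => insert S F) ?_ ?_ ?_ ?_ ?_
  · intro T hT
    exact Finset.mem_filter.2 ⟨erase_mem_forests (mem_trees.1 hT).1 hS, Finset.notMem_erase _ _⟩
  · intro F hF
    exact insert_mem_trees (Finset.mem_filter.1 hF).1 (Finset.card_pos.1 (by omega))
  · intro T hT
    exact Finset.insert_erase (mem_trees.1 hT).2
  · intro F hF
    exact Finset.erase_insert (Finset.mem_filter.1 hF).2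
  · intro T hT
    rw [Finset.insert_erase (mem_trees.1 hT).2]

theorem children_insert_self {S : Finset α} {F : Finset (Finset α)} (hF : F ∈ forests S)
    (hS : S ∉ F) : children (insert S F) S = roots F := by
  have h1 := (mem_forests.1 hF).1
  have h2 : ∀ A ∈ F, A ⊂ S := fun A hA => (h1 A hA).ssubset_of_ne fun h => hS (h ▸ hA)
  ext C
  simp only [children, roots, Finset.mem_filter, Finset.mem_insert]
  constructor
  · rintro ⟨rfl | hC, hCS, hmax⟩
    · exact absurd hCS (ssubset_irrefl _)
    · exact ⟨hC, fun B hB hCB => hmax B (.inr hB) hCB (h2 B hB)⟩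
  · rintro ⟨hC, hmax⟩
    refine ⟨.inr hC, h2 C hC, ?_⟩
    rintro B (rfl | hB) hCB
    · exact ssubset_irrefl _
    · exact absurd hCB (hmax B hB)

theorem children_insert_of_mem {S A : Finset α} {F : Finset (Finset α)} (hF : F ∈ forests S)
    (hA : A ∈ F) : children (insert S F) A = children F A := by
  have hAS : ¬ S ⊂ A := fun h => h.2 ((mem_forests.1 hF).1 A hA)
  ext C
  simp only [children, Finset.mem_filter, Finset.mem_insert]
  constructor
  · rintro ⟨rfl | hC, hCA, hmax⟩
    · exact absurd hCA hAS
    · exact ⟨hC, hCA, fun B hB => hmax B (.inr hB)⟩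
  · rintro ⟨hC, hCA, hmax⟩
    refine ⟨.inr hC, hCA, ?_⟩
    rintro B (rfl | hB) hCB
    · exact hAS
    · exact hmax B hB hCB

theorem forestWeight_insert (v : Finset α → Finset (Finset α) → ℂ) {S : Finset α}
    {F : Finset (Finset α)} (hF : F ∈ forests S) (hS : S ∉ F) (hc : 2 ≤ S.card) :
    forestWeight v (insert S F) = v S (roots F) * forestWeight v F := by
  unfold forestWeight
  rw [Finset.filter_insert, if_pos hc, Finset.prod_insert (by simp [hS]),
    children_insert_self hF hS]
  congr 1
  refine Finset.prod_congr rfl fun A hA => ?_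
  rw [children_insert_of_mem hF (Finset.mem_filter.1 hA).1]

/-! #### Splitting off the tree below a root -/

theorem filter_subset_mem_trees {S R : Finset α} {F : Finset (Finset α)} (hF : F ∈ forests S)
    (hR : R ∈ F) : F.filter (· ⊆ R) ∈ trees R := by
  obtain ⟨h1, h2, h3, h4⟩ := mem_forests.1 hF
  refine mem_trees.2 ⟨mem_forests.2 ⟨?_, ?_, ?_, ?_⟩, ?_⟩
  · exact fun A hA => (Finset.mem_filter.1 hA).2
  · exact fun h => h2 (Finset.mem_filter.1 h).1
  · exact fun j hj => Finset.mem_filter.2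
      ⟨h3 j (h1 R hR hj), Finset.singleton_subset_iff.2 hj⟩
  · exact fun A hA B hB => h4 A (Finset.mem_filter.1 hA).1 B (Finset.mem_filter.1 hB).1
  · exact Finset.mem_filter.2 ⟨hR, subset_rfl⟩

theorem filter_not_subset_mem_forests {S R : Finset α} {F : Finset (Finset α)}
    (hF : F ∈ forests S) (hR : R ∈ roots F) :
    F.filter (fun A => ¬ A ⊆ R) ∈ forests (S \ R) := by
  obtain ⟨h1, h2, h3, h4⟩ := mem_forests.1 hF
  refine mem_forests.2 ⟨?_, ?_, ?_, ?_⟩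
  · intro A hA
    obtain ⟨hA, hAR⟩ := Finset.mem_filter.1 hA
    exact Finset.subset_sdiff.2
      ⟨h1 A hA, (subset_or_disjoint_of_mem_roots hF hR hA).resolve_left hAR⟩
  · exact fun h => h2 (Finset.mem_filter.1 h).1
  · intro j hj
    obtain ⟨hjS, hjR⟩ := Finset.mem_sdiff.1 hj
    exact Finset.mem_filter.2 ⟨h3 j hjS, by simpa using hjR⟩
  · exact fun A hA B hB => h4 A (Finset.mem_filter.1 hA).1 B (Finset.mem_filter.1 hB).1

theorem disjoint_of_mem_tree_of_mem_forest {S R A B : Finset α} {T F : Finset (Finset α)}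
    (hT : T ∈ forests R) (hF : F ∈ forests (S \ R)) (hA : A ∈ T) (hB : B ∈ F) :
    Disjoint A B :=
  Finset.disjoint_of_subset_left ((mem_forests.1 hT).1 A hA)
    (Finset.subset_sdiff.1 ((mem_forests.1 hF).1 B hB)).2.symm

theorem union_mem_forests {S R : Finset α} {T F : Finset (Finset α)} (hRS : R ⊆ S)
    (hT : T ∈ forests R) (hF : F ∈ forests (S \ R)) : T ∪ F ∈ forests S := by
  obtain ⟨h1, h2, h3, h4⟩ := mem_forests.1 hT
  obtain ⟨k1, k2, k3, k4⟩ := mem_forests.1 hF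
  refine mem_forests.2 ⟨?_, ?_, ?_, ?_⟩
  · intro A hA
    rcases Finset.mem_union.1 hA with hA | hA
    · exact (h1 A hA).trans hRS
    · exact (k1 A hA).trans Finset.sdiff_subset
  · simp [h2, k2]
  · intro j hj
    by_cases hjR : j ∈ R
    · exact Finset.mem_union_left _ (h3 j hjR)
    · exact Finset.mem_union_right _ (k3 j (Finset.mem_sdiff.2 ⟨hj, hjR⟩))
  · intro A hA B hB
    rcases Finset.mem_union.1 hA with hA | hA <;> rcases Finset.mem_union.1 hB with hB | hB
    · exact h4 A hA B hB
    · exact .inr (.inr (disjoint_of_mem_tree_of_mem_forest hT hF hA hB))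
    · exact .inr (.inr (disjoint_of_mem_tree_of_mem_forest hT hF hB hA).symm)
    · exact k4 A hA B hB

theorem roots_union {S R : Finset α} {T F : Finset (Finset α)} (hT : T ∈ trees R)
    (hF : F ∈ forests (S \ R)) : roots (T ∪ F) = insert R (roots F) := by
  obtain ⟨hT, hR⟩ := mem_trees.1 hT
  have hsub := (mem_forests.1 hT).1
  have hd := fun {A B} => disjoint_of_mem_tree_of_mem_forest (A := A) (B := B) hT hF
  ext A
  simp only [roots, Finset.mem_filter, Finset.mem_insert, Finset.mem_union]
  constructor
  · rintro ⟨hA | hA, hmax⟩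
    · left
      by_contra hne
      exact hmax R (.inl hR) ((hsub A hA).ssubset_of_ne hne)
    · exact .inr ⟨hA, fun B hB => hmax B (.inr hB)⟩
  · rintro (rfl | ⟨hA, hmax⟩)
    · refine ⟨.inl hR, ?_⟩
      rintro B (hB | hB) hAB
      · exact hAB.2 (hsub B hB)
      · exact not_subset_of_disjoint (nonempty_of_mem_forest hT hR) (hd hR hB) hAB.1
    · refine ⟨.inr hA, ?_⟩
      rintro B (hB | hB) hAB
      · exact not_subset_of_disjoint (nonempty_of_mem_forest hF hA) (hd hB hA).symm hAB.1
      · exact hmax B hB hAB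

theorem notMem_of_mem_forests_sdiff {S R : Finset α} {F : Finset (Finset α)}
    (hR : R.Nonempty) (hF : F ∈ forests (S \ R)) : R ∉ F := fun h =>
  not_subset_of_disjoint hR Finset.disjoint_sdiff ((mem_forests.1 hF).1 R h)

theorem card_roots_union {S R : Finset α} {T F : Finset (Finset α)} (hT : T ∈ trees R)
    (hF : F ∈ forests (S \ R)) : (roots (T ∪ F)).card = (roots F).card + 1 := by
  rw [roots_union hT hF, Finset.card_insert_of_notMem]
  obtain ⟨hT, hR⟩ := mem_trees.1 hT
  exact fun h => notMem_of_mem_forests_sdiff (nonempty_of_mem_forest hT hR) hF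
    (Finset.mem_filter.1 h).1

/-- Members of a family that are disjoint from `A` do not influence the children of `A`. -/
theorem children_union {A : Finset α} {T F : Finset (Finset α)} (hF : ∅ ∉ F)
    (hd : ∀ B ∈ F, Disjoint A B) : children (T ∪ F) A = children T A := by
  have hns : ∀ B ∈ F, ¬ B ⊂ A := fun B hB h =>
    not_subset_of_disjoint (Finset.nonempty_iff_ne_empty.2 fun h => hF (h ▸ hB))
      (hd B hB).symm h.1
  ext C
  simp only [children, Finset.mem_filter, Finset.mem_union]
  constructor
  · rintro ⟨hC | hC, hCA, hmax⟩
    · exact ⟨hC, hCA, fun B hB => hmax B (.inl hB)⟩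
    · exact absurd hCA (hns C hC)
  · rintro ⟨hC, hCA, hmax⟩
    refine ⟨.inl hC, hCA, ?_⟩
    rintro B (hB | hB) hCB
    · exact hmax B hB hCB
    · exact hns B hB

theorem disjoint_tree_forest {S R : Finset α} {T F : Finset (Finset α)}
    (hT : T ∈ forests R) (hF : F ∈ forests (S \ R)) : Disjoint T F :=
  Finset.disjoint_left.2 fun _ hA hA' =>
    not_subset_of_disjoint (nonempty_of_mem_forest hT hA)
      (disjoint_of_mem_tree_of_mem_forest hT hF hA hA') subset_rfl

/-- The children of a vertex lie inside it, so members of the other, disjoint part do not affect its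
factor. -/
theorem forestWeight_union (v : Finset α → Finset (Finset α) → ℂ) {S R : Finset α}
    {T F : Finset (Finset α)} (hT : T ∈ forests R) (hF : F ∈ forests (S \ R)) :
    forestWeight v (T ∪ F) = forestWeight v T * forestWeight v F := by
  unfold forestWeight
  rw [Finset.filter_union, Finset.prod_union
    (Finset.disjoint_filter_filter (disjoint_tree_forest hT hF))]
  congr 1
  · refine Finset.prod_congr rfl fun A hA => ?_
    rw [children_union (mem_forests.1 hF).2.1 fun B hB =>
      disjoint_of_mem_tree_of_mem_forest hT hF (Finset.mem_filter.1 hA).1 hB]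
  · refine Finset.prod_congr rfl fun A hA => ?_
    rw [Finset.union_comm, children_union (mem_forests.1 hT).2.1 fun B hB =>
      (disjoint_of_mem_tree_of_mem_forest hT hF hB (Finset.mem_filter.1 hA).1).symm]

/-- The sum over all forests on `S`, weighted by a function of the number of roots. -/
def forestSum (v : Finset α → Finset (Finset α) → ℂ) (h : ℕ → ℂ) (S : Finset α) : ℂ :=
  ∑ F ∈ forests S, h (roots F).card * forestWeight v F

/-- A forest with root `R` is a tree on `R` together with a forest on `S \ R`; the shift of `h`
accounts for the root split off. -/
theorem sum_forests_of_mem_roots (v : Finset α → Finset (Finset α) → ℂ) (h : ℕ → ℂ)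
    {S R : Finset α} (hRS : R ⊆ S) :
    ∑ F ∈ (forests S).filter (fun F => R ∈ roots F), h (roots F).card * forestWeight v F =
      (∑ T ∈ trees R, forestWeight v T) * forestSum v (fun k => h (k + 1)) (S \ R) := by
  rw [forestSum, Finset.sum_mul_sum, ← Finset.sum_product']
  refine Finset.sum_nbij' (fun F => (F.filter (· ⊆ R), F.filter (fun A => ¬ A ⊆ R)))
    (fun P => P.1 ∪ P.2) ?_ ?_ ?_ ?_ ?_
  · intro F hF
    obtain ⟨hF, hR⟩ := Finset.mem_filter.1 hF
    exact Finset.mem_product.2 ⟨filter_subset_mem_trees hF (Finset.mem_filter.1 hR).1,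
      filter_not_subset_mem_forests hF hR⟩
  · rintro ⟨T, F⟩ hP
    obtain ⟨hT, hF⟩ := Finset.mem_product.1 hP
    refine Finset.mem_filter.2 ⟨union_mem_forests hRS (mem_trees.1 hT).1 hF, ?_⟩
    rw [roots_union hT hF]
    exact Finset.mem_insert_self _ _
  · intro F _
    exact Finset.filter_union_filter_not_eq _ _
  · rintro ⟨T, F⟩ hP
    obtain ⟨hT, hF⟩ := Finset.mem_product.1 hP
    obtain ⟨hT, hR⟩ := mem_trees.1 hT
    have h1 : ∀ A ∈ T, A ⊆ R := (mem_forests.1 hT).1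
    have h2 : ∀ A ∈ F, ¬ A ⊆ R := fun A hA =>
      not_subset_of_disjoint (nonempty_of_mem_forest hF hA)
        (Finset.subset_sdiff.1 ((mem_forests.1 hF).1 A hA)).2
    refine Prod.ext ?_ ?_
    · ext A
      simp only [Finset.mem_filter, Finset.mem_union]
      exact ⟨fun h => h.1.resolve_right fun hA => h2 A hA h.2, fun h => ⟨.inl h, h1 A h⟩⟩
    · ext A
      simp only [Finset.mem_filter, Finset.mem_union]
      exact ⟨fun h => h.1.resolve_left fun hA => h.2 (h1 A hA), fun h => ⟨.inr h, h2 A h⟩⟩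
  · intro F hF
    obtain ⟨hF, hR⟩ := Finset.mem_filter.1 hF
    have hT := filter_subset_mem_trees hF (Finset.mem_filter.1 hR).1
    have hF' := filter_not_subset_mem_forests hF hR
    have hu : F.filter (· ⊆ R) ∪ F.filter (fun A => ¬ A ⊆ R) = F :=
      Finset.filter_union_filter_not_eq _ _
    have hc := card_roots_union hT hF'
    have hw := forestWeight_union v (mem_trees.1 hT).1 hF'
    rw [hu] at hc hw
    simp only [hc, hw]
    ring

/-- Sums over the roots of all forests on `S`. -/
theorem sum_forests_sum_roots (v : Finset α → Finset (Finset α) → ℂ) (h : ℕ → ℂ)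
    (y : Finset α → ℂ) (S : Finset α) :
    ∑ F ∈ forests S, h (roots F).card * (∑ R ∈ roots F, y R) * forestWeight v F =
      ∑ R ∈ S.powerset, y R * (∑ T ∈ trees R, forestWeight v T) *
        forestSum v (fun k => h (k + 1)) (S \ R) := by
  have : ∀ F ∈ forests S, h (roots F).card * (∑ R ∈ roots F, y R) * forestWeight v F =
      ∑ R ∈ S.powerset, if R ∈ roots F then y R * (h (roots F).card * forestWeight v F) else 0 := by
    intro F hF
    rw [← Finset.sum_filter, Finset.filter_mem_eq_inter, Finset.inter_eq_right.2,
      ← Finset.sum_mul]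
    · ring
    · exact fun R hR => Finset.mem_powerset.2
        ((mem_forests.1 hF).1 R (Finset.mem_filter.1 hR).1)
  rw [Finset.sum_congr rfl this, Finset.sum_comm]
  refine Finset.sum_congr rfl fun R hR => ?_
  rw [← Finset.sum_filter, ← Finset.mul_sum,
    sum_forests_of_mem_roots v h (Finset.mem_powerset.1 hR), mul_assoc]

/-- A forest sum, expanded over the tree that contains the element `j`. -/
theorem forestSum_eq_sum_mem (v : Finset α → Finset (Finset α) → ℂ) (h : ℕ → ℂ)
    {S : Finset α} {j : α} (hj : j ∈ S) :
    forestSum v h S = ∑ R ∈ S.powerset, (if j ∈ R then 1 else 0) *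
      (∑ T ∈ trees R, forestWeight v T) * forestSum v (fun k => h (k + 1)) (S \ R) := by
  -- Here `y R` is the indicator of `j ∈ R`; exactly one root contains `j`, so the sum over the
  -- roots is 1.
  rw [← sum_forests_sum_roots, forestSum]
  refine Finset.sum_congr rfl fun F hF => ?_
  obtain ⟨R, ⟨hR, hjR⟩, huniq⟩ := existsUnique_mem_roots hF hj
  rw [Finset.sum_eq_single_of_mem R hR, if_pos hjR, mul_one]
  exact fun R' hR' hne => if_neg fun hj' => hne (huniq R' ⟨hR', hj'⟩)

end Forests

/-! ### Exponential generating functions -/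

section GeneratingFunctions

open PowerSeries

/-- The coefficient of `t ^ n / n!` in a power series. -/
noncomputable def egfCoeff (A : PowerSeries ℂ) (n : ℕ) : ℂ :=
  (n.factorial : ℂ) * coeff n A

theorem egfCoeff_expSeries (h : ℕ → ℂ) (n : ℕ) : egfCoeff (expSeries h) n = h n := by
  have : (n.factorial : ℂ) ≠ 0 := Nat.cast_ne_zero.2 n.factorial_ne_zero
  simp only [egfCoeff, expSeries, coeff_mk]
  field_simp

theorem egfCoeff_add (A B : PowerSeries ℂ) (n : ℕ) :
    egfCoeff (A + B) n = egfCoeff A n + egfCoeff B n := by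
  simp [egfCoeff, mul_add]

theorem egfCoeff_sub (A B : PowerSeries ℂ) (n : ℕ) :
    egfCoeff (A - B) n = egfCoeff A n - egfCoeff B n := by
  simp [egfCoeff, mul_sub]

theorem egfCoeff_derivative (A : PowerSeries ℂ) (n : ℕ) :
    egfCoeff (derivative ℂ A) n = egfCoeff A (n + 1) := by
  simp only [egfCoeff, coeff_derivative, Nat.factorial_succ]
  push_cast
  ring

theorem egfCoeff_X_mul (A : PowerSeries ℂ) (n : ℕ) :
    egfCoeff (X * A) (n + 1) = (n + 1) * egfCoeff A n := by
  simp only [egfCoeff, coeff_succ_X_mul, Nat.factorial_succ]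
  push_cast
  ring

/-- Splitting off one root shifts `h`, which is differentiation on the level of series. -/
theorem expSeries_shift (h : ℕ → ℂ) :
    expSeries (fun k => h (k + 1)) = derivative ℂ (expSeries h) := by
  ext n
  have h1 : (n.factorial : ℂ) ≠ 0 := Nat.cast_ne_zero.2 n.factorial_ne_zero
  have h2 : (n : ℂ) + 1 ≠ 0 := Nat.cast_add_one_ne_zero n
  simp only [coeff_derivative, expSeries, coeff_mk, Nat.factorial_succ]
  push_cast
  field_simp

/-- The product of exponential generating functions, as a sum over the subsets of a finite set. -/
theorem egfCoeff_mul {α : Type*} [DecidableEq α] (A B : PowerSeries ℂ) (S : Finset α) :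
    egfCoeff (A * B) S.card = ∑ R ∈ S.powerset, egfCoeff A R.card * egfCoeff B (S \ R).card := by
  have h : ∀ R ∈ S.powerset, egfCoeff A R.card * egfCoeff B (S \ R).card =
      (fun k => egfCoeff A k * egfCoeff B (S.card - k)) R.card := fun R hR => by
    simp only [Finset.card_sdiff_of_subset (Finset.mem_powerset.1 hR)]
  rw [Finset.sum_congr rfl h, Finset.sum_powerset_apply_card
    (fun k => egfCoeff A k * egfCoeff B (S.card - k)), egfCoeff, coeff_mul,
    Finset.Nat.sum_antidiagonal_eq_sum_range_succ_mk, Finset.mul_sum]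
  refine Finset.sum_congr rfl fun k hk => ?_
  have hk : k ≤ S.card := Nat.lt_succ_iff.1 (Finset.mem_range.1 hk)
  rw [← Nat.choose_mul_factorial_mul_factorial hk]
  simp only [egfCoeff, nsmul_eq_mul]
  push_cast
  ring

/-- The product of exponential generating functions, as a sum over the subsets of a finite set
that contain a fixed subset `K`. -/
theorem sum_powerset_superset {α : Type*} [DecidableEq α] (A A' B : PowerSeries ℂ)
    {S K : Finset α} (hK : K ⊆ S) (hA : ∀ n, egfCoeff A' n = egfCoeff A (n + K.card)) :
    ∑ R ∈ S.powerset, (if K ⊆ R then 1 else 0) * egfCoeff A R.card * egfCoeff B (S \ R).card =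
      egfCoeff (A' * B) (S \ K).card := by
  simp only [ite_mul, one_mul, zero_mul]
  rw [egfCoeff_mul, ← Finset.sum_filter]
  refine Finset.sum_nbij' (fun R => R \ K) (fun R => R ∪ K) ?_ ?_ ?_ ?_ ?_
  · intro R hR
    obtain ⟨hR, -⟩ := Finset.mem_filter.1 hR
    exact Finset.mem_powerset.2 (Finset.sdiff_subset_sdiff (Finset.mem_powerset.1 hR) subset_rfl)
  · intro R hR
    exact Finset.mem_filter.2 ⟨Finset.mem_powerset.2 (Finset.union_subset
      ((Finset.mem_powerset.1 hR).trans Finset.sdiff_subset) hK), Finset.subset_union_right⟩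
  · intro R hR
    exact Finset.sdiff_union_of_subset (Finset.mem_filter.1 hR).2
  · intro R hR
    exact Finset.union_sdiff_cancel_right
      (Finset.subset_sdiff.1 (Finset.mem_powerset.1 hR)).2
  · intro R hR
    have hKR := (Finset.mem_filter.1 hR).2
    rw [hA, Finset.card_sdiff_add_card_eq_card hKR]
    congr 3
    ext x
    simp only [Finset.mem_sdiff]
    have := @hKR x
    tauto

/-! ### Composition with the inverse series. -/

theorem hasSubst_expSeries {b : ℕ → ℂ} (hb : b 0 = 0) : HasSubst (expSeries b) := by
  refine HasSubst.of_constantCoeff_zero' ?_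
  rw [← coeff_zero_eq_constantCoeff_apply]
  simp [expSeries, hb]

theorem egfCoeff_subst_zero {b : ℕ → ℂ} (hb : b 0 = 0) (A : PowerSeries ℂ) :
    egfCoeff (A.subst (expSeries b)) 0 = egfCoeff A 0 := by
  have hs := hasSubst_expSeries hb
  have h0 : constantCoeff (expSeries b) = 0 := by
    rw [← coeff_zero_eq_constantCoeff_apply]
    simp [expSeries, hb]
  have : A = X * mk (fun n => coeff (n + 1) A) + C (constantCoeff A) :=
    eq_X_mul_shift_add_const A
  simp only [egfCoeff, Nat.factorial_zero, Nat.cast_one, one_mul]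
  conv_lhs => rw [this]
  rw [subst_add hs, subst_mul hs, subst_X hs, map_add, coeff_zero_eq_constantCoeff_apply,
    map_mul, h0, zero_mul, zero_add]
  have hC : (C (constantCoeff A)).subst (expSeries b) = C (constantCoeff A) := subst_C _
  rw [hC]
  simp

/-- The chain rule, in the form that matches the removal of the tree containing a chosen element. -/
theorem egfCoeff_subst_succ {b : ℕ → ℂ} (hb : b 0 = 0) (h : ℕ → ℂ) (n : ℕ) :
    egfCoeff ((expSeries h).subst (expSeries b)) (n + 1) =
      egfCoeff (derivative ℂ (expSeries b) *
        (expSeries fun k => h (k + 1)).subst (expSeries b)) n := by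
  rw [← egfCoeff_derivative, derivative_subst (hasSubst_expSeries hb), expSeries_shift, mul_comm]

/-! ### Forest sums as coefficients of composed series. -/

variable {α : Type*} [DecidableEq α]

theorem forestSum_empty (v : Finset α → Finset (Finset α) → ℂ) (h : ℕ → ℂ) :
    forestSum v h ∅ = h 0 := by
  simp [forestSum, forests_empty, roots, forestWeight]

theorem sum_powerset_mem {b : ℕ → ℂ} (B : PowerSeries ℂ) {S : Finset α} {j : α} (hj : j ∈ S) :
    ∑ R ∈ S.powerset, (if j ∈ R then 1 else 0) * b R.card * egfCoeff B (S \ R).card =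
      egfCoeff (derivative ℂ (expSeries b) * B) (S.card - 1) := by
  have := sum_powerset_superset (expSeries b) (derivative ℂ (expSeries b)) B
    (Finset.singleton_subset_iff.2 hj) (fun n => by rw [egfCoeff_derivative]; rfl)
  rw [Finset.card_sdiff_of_subset (Finset.singleton_subset_iff.2 hj), Finset.card_singleton] at this
  simpa only [Finset.singleton_subset_iff, egfCoeff_expSeries] using this

/-- If the sum over all trees on `R` is `b |R|`, then forest sums are given by the composition of
exponential generating functions. -/
theorem forestSum_eq_egfCoeff_subst (v : Finset α → Finset (Finset α) → ℂ) {b : ℕ → ℂ}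
    (hb : b 0 = 0) (S : Finset α) (h : ℕ → ℂ)
    (hJ : ∀ R ⊆ S, R.Nonempty → ∑ T ∈ trees R, forestWeight v T = b R.card) :
    forestSum v h S = egfCoeff ((expSeries h).subst (expSeries b)) S.card := by
  -- Splitting off the tree through `j` replaces `h` by its shift, so the induction must hold for
  -- all `h`.
  induction S using Finset.strongInduction generalizing h with
  | H S ih =>
    rcases S.eq_empty_or_nonempty with rfl | ⟨j, hj⟩
    · rw [forestSum_empty, Finset.card_empty, egfCoeff_subst_zero hb, egfCoeff_expSeries]
    · obtain ⟨n, hn⟩ : ∃ n, S.card = n + 1 :=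
        ⟨S.card - 1, (Nat.sub_add_cancel (Finset.card_pos.2 ⟨j, hj⟩)).symm⟩
      rw [hn, egfCoeff_subst_succ hb, forestSum_eq_sum_mem v h hj, ← Nat.add_sub_cancel n 1, ← hn,
        ← sum_powerset_mem _ hj]
      refine Finset.sum_congr rfl fun R hR => ?_
      have hRS := Finset.mem_powerset.1 hR
      by_cases hjR : j ∈ R
      · rw [hJ R hRS ⟨j, hjR⟩, ih (S \ R) (Finset.sdiff_ssubset hRS ⟨j, hjR⟩)]
        exact fun Q hQ => hJ Q (hQ.trans Finset.sdiff_subset)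
      · simp [hjR]

/-- For `R = S` the tree sum is not yet known, but the other factor is `h 1 = 0`, so both sides
vanish. -/
theorem treeSum_mul_forestSum (v : Finset α → Finset (Finset α) → ℂ) {b : ℕ → ℂ}
    (hb : b 0 = 0) {S : Finset α} {h : ℕ → ℂ} (h1 : h 1 = 0)
    (hJ : ∀ R ⊂ S, R.Nonempty → ∑ T ∈ trees R, forestWeight v T = b R.card)
    {R : Finset α} (hRS : R ⊆ S) (hR : R.Nonempty) :
    (∑ T ∈ trees R, forestWeight v T) * forestSum v (fun k => h (k + 1)) (S \ R) =
      b R.card * egfCoeff ((expSeries fun k => h (k + 1)).subst (expSeries b)) (S \ R).card := by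
  rcases eq_or_ne R S with rfl | hne
  · rw [Finset.sdiff_self, forestSum_empty, Finset.card_empty, egfCoeff_subst_zero hb,
      egfCoeff_expSeries]
    simp [h1]
  · rw [hJ R (hRS.ssubset_of_ne hne) hR, forestSum_eq_egfCoeff_subst v hb]
    exact fun Q hQ => hJ Q ((Finset.sdiff_ssubset hRS hR).trans_le' hQ)

/-- The variant of `forestSum_eq_egfCoeff_subst` in which forests with a single root do not
contribute. -/
theorem forestSum_eq_egfCoeff_subst_of_ssubset (v : Finset α → Finset (Finset α) → ℂ) {b : ℕ → ℂ}
    (hb : b 0 = 0) {S : Finset α} (hS : S.Nonempty) {h : ℕ → ℂ} (h1 : h 1 = 0)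
    (hJ : ∀ R ⊂ S, R.Nonempty → ∑ T ∈ trees R, forestWeight v T = b R.card) :
    forestSum v h S = egfCoeff ((expSeries h).subst (expSeries b)) S.card := by
  obtain ⟨j, hj⟩ := hS
  obtain ⟨n, hn⟩ : ∃ n, S.card = n + 1 :=
    ⟨S.card - 1, (Nat.sub_add_cancel (Finset.card_pos.2 ⟨j, hj⟩)).symm⟩
  rw [hn, egfCoeff_subst_succ hb, forestSum_eq_sum_mem v h hj, ← Nat.add_sub_cancel n 1, ← hn,
    ← sum_powerset_mem _ hj]
  refine Finset.sum_congr rfl fun R hR => ?_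
  by_cases hjR : j ∈ R
  · rw [mul_assoc, mul_assoc,
      treeSum_mul_forestSum v hb h1 hJ (Finset.mem_powerset.1 hR) ⟨j, hjR⟩]
  · simp [hjR]

end GeneratingFunctions

/-! ### The generating functions of the Feynman rules -/

section FeynmanRules

open PowerSeries

theorem coeff_derivative_diffeo (a : ℕ → ℂ) (n : ℕ) :
    coeff n (derivative ℂ (diffeo a)) = (n + 1) * a n := by
  rw [coeff_derivative, diffeo, coeff_mk, if_neg n.succ_ne_zero, Nat.add_sub_cancel, mul_comm]

/-- The generating function of `f`: the derivative of `∑ f_{k+1} t^k / k!` is half of the square of the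
derivative of `φ`, minus one half. -/
theorem two_mul_expSeries_fCoeff {a : ℕ → ℂ} (ha : a 0 = 1) :
    2 * expSeries (fun k => fCoeff a (k + 2)) = derivative ℂ (diffeo a) ^ 2 - 1 := by
  -- The series u in both Bell polynomials is φ' - 1, the constant term being `a 0 = 1`. Hence the
  -- sum of the two is u + u²/2.
  have hu : (mk fun j => if j = 0 then 0 else ((j + 1).factorial : ℂ) * a j / (j.factorial : ℂ)) =
      derivative ℂ (diffeo a) - 1 := by
    ext n
    rw [coeff_mk, map_sub, coeff_derivative_diffeo, coeff_one]
    split_ifs with h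
    · simp [h, ha]
    · have : (n.factorial : ℂ) ≠ 0 := Nat.cast_ne_zero.2 n.factorial_ne_zero
      rw [Nat.factorial_succ]
      push_cast
      field_simp
      ring
  have hf : 2 * expSeries (fun k => fCoeff a (k + 2)) =
      2 * (derivative ℂ (diffeo a) - 1) + (derivative ℂ (diffeo a) - 1) ^ 2 := by
    ext n
    have : (n.factorial : ℂ) ≠ 0 := Nat.cast_ne_zero.2 n.factorial_ne_zero
    simp only [two_mul, map_add, expSeries, coeff_mk, fCoeff, bell, Nat.add_sub_cancel, hu,
      pow_one, Nat.factorial_one, Nat.factorial_two]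
    push_cast
    field_simp
    ring
  rw [hf]
  ring

theorem cCoeff_eq_coeff_diffeo_sq (a : ℕ → ℂ) (n : ℕ) :
    cCoeff a n = (n.factorial : ℂ) / 2 * coeff n (diffeo a ^ 2) := by
  have : (mk fun j => if j = 0 then 0 else (j.factorial : ℂ) * a (j - 1) / (j.factorial : ℂ)) =
      diffeo a := by
    ext n
    have : (n.factorial : ℂ) ≠ 0 := Nat.cast_ne_zero.2 n.factorial_ne_zero
    simp only [diffeo, coeff_mk]
    split_ifs
    · rfl
    · field_simp
  rw [cCoeff, bell, this, Nat.factorial_two, Nat.cast_ofNat]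

/-- The numbers `cCoeff a n` are the exponential coefficients of φ²/2, and the index shift
differentiates it. -/
theorem expSeries_cCoeff (a : ℕ → ℂ) :
    expSeries (fun k => cCoeff a (k + 1)) = diffeo a * derivative ℂ (diffeo a) := by
  have h : derivative ℂ (diffeo a ^ 2) = diffeo a * derivative ℂ (diffeo a) +
      diffeo a * derivative ℂ (diffeo a) := by
    rw [sq, Derivation.leibniz, smul_eq_mul]
  ext n
  have hn := congrArg (coeff n) h
  have : (n.factorial : ℂ) ≠ 0 := Nat.cast_ne_zero.2 n.factorial_ne_zero
  rw [coeff_derivative, map_add] at hn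
  simp only [expSeries, coeff_mk, cCoeff_eq_coeff_diffeo_sq, Nat.factorial_succ]
  push_cast
  field_simp
  linear_combination hn

theorem cCoeff_two {a : ℕ → ℂ} (ha : a 0 = 1) : cCoeff a 2 = 1 := by
  simp [cCoeff_eq_coeff_diffeo_sq, sq, coeff_mul, Finset.Nat.antidiagonal_succ, diffeo, ha]

/-- The vertex sum may therefore include forests with a single root without changing the terms with
f. -/
theorem fCoeff_two (a : ℕ → ℂ) : fCoeff a 2 = 0 := by
  simp [fCoeff, bell]

/-- The coefficients `c` with the term of valence two removed. -/
noncomputable def vertexC (a : ℕ → ℂ) (k : ℕ) : ℂ :=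
  if k = 1 then 0 else cCoeff a (k + 1)

theorem expSeries_vertexC {a : ℕ → ℂ} (ha : a 0 = 1) :
    expSeries (vertexC a) = diffeo a * derivative ℂ (diffeo a) - X := by
  rw [← expSeries_cCoeff]
  ext n
  rw [map_sub, coeff_X]
  simp only [expSeries, coeff_mk, vertexC]
  split_ifs with h
  · simp [h, cCoeff_two ha]
  · simp

/-! ### Series identities for the inverse diffeomorphism. -/

variable {a b : ℕ → ℂ}

theorem derivative_diffeo_subst_mul (hb : IsInverseDiffeo a b) :
    (derivative ℂ (diffeo a)).subst (expSeries b) * derivative ℂ (expSeries b) = 1 := by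
  rw [← derivative_subst (hasSubst_expSeries hb.zero), hb.right_inv, derivative_X]

theorem inverse_coeff_one (ha : a 0 = 1) (hb : IsInverseDiffeo a b) : b 1 = 1 := by
  have h := congrArg constantCoeff (derivative_diffeo_subst_mul hb)
  have h0 := egfCoeff_subst_zero hb.zero (derivative ℂ (diffeo a))
  simp only [egfCoeff, Nat.factorial_zero, Nat.cast_one, one_mul, coeff_derivative_diffeo, ha] at h0
  rw [map_mul, ← coeff_zero_eq_constantCoeff_apply, ← coeff_zero_eq_constantCoeff_apply, h0,
    coeff_derivative] at h
  simpa [expSeries] using h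

theorem two_mul_fCoeff_subst (ha : a 0 = 1) (hb : IsInverseDiffeo a b) :
    2 * (expSeries fun k => fCoeff a (k + 2)).subst (expSeries b) =
      (derivative ℂ (diffeo a)).subst (expSeries b) ^ 2 - 1 := by
  have hs := hasSubst_expSeries hb.zero
  have h := congrArg (substAlgHom (R := ℂ) hs) (two_mul_expSeries_fCoeff ha)
  rw [map_mul, map_sub, map_pow, map_one, map_ofNat] at h
  simpa only [coe_substAlgHom] using h

/-- Onshell part of the identity for the tree sums. -/
theorem onshell_identity (ha : a 0 = 1) (hb : IsInverseDiffeo a b) {n : ℕ} (hn : 1 ≤ n) :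
    (n : ℂ) * (2 * egfCoeff ((expSeries fun k => fCoeff a (k + 1)).subst (expSeries b)) n + b n) =
      egfCoeff ((expSeries (vertexC a)).subst (expSeries b)) n + b n := by
  obtain ⟨n, rfl⟩ := Nat.exists_eq_add_of_le' hn
  have hs := hasSubst_expSeries hb.zero
  have hP := derivative_diffeo_subst_mul hb
  have hW := two_mul_fCoeff_subst ha hb
  set P := (derivative ℂ (diffeo a)).subst (expSeries b)
  have hl : (expSeries (vertexC a)).subst (expSeries b) = X * P - expSeries b := by
    rw [expSeries_vertexC ha, subst_sub hs, subst_mul hs, hb.right_inv, subst_X hs]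
  -- The derivative of F∘ρ is ρ'·(F'∘ρ), and twice this is ρ'(P² - 1) = P - ρ', since Pρ' = 1.
  have h1 : 2 * egfCoeff ((expSeries fun k => fCoeff a (k + 1)).subst (expSeries b)) (n + 1) =
      egfCoeff P n - b (n + 1) := by
    rw [egfCoeff_subst_succ hb.zero, two_mul, ← egfCoeff_add, ← egfCoeff_expSeries b (n + 1),
      ← egfCoeff_derivative, ← egfCoeff_sub]
    congr 1
    linear_combination derivative ℂ (expSeries b) * hW + P * hP
  rw [h1, hl, egfCoeff_sub, egfCoeff_X_mul, egfCoeff_expSeries]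
  push_cast
  ring

/-- Offshell part of the identity for the tree sums. -/
theorem offshell_identity (ha : a 0 = 1) (hb : IsInverseDiffeo a b) (n : ℕ) :
    egfCoeff ((expSeries fun k => fCoeff a (k + 1)).subst (expSeries b)) (n + 2) +
      egfCoeff (derivative ℂ (derivative ℂ (expSeries b)) *
        (expSeries fun k => fCoeff a (k + 2)).subst (expSeries b)) n + b (n + 2) = 0 := by
  have hP := derivative_diffeo_subst_mul hb
  have hW := two_mul_fCoeff_subst ha hb
  have hdP := congrArg (derivative ℂ) hP
  have hdW := congrArg (derivative ℂ) hW
  rw [egfCoeff_subst_succ hb.zero, ← egfCoeff_derivative, ← egfCoeff_expSeries b,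
    ← egfCoeff_derivative, ← egfCoeff_derivative, ← egfCoeff_add, ← egfCoeff_add]
  set P := (derivative ℂ (diffeo a)).subst (expSeries b)
  set W := (expSeries fun k => fCoeff a (k + 2)).subst (expSeries b)
  set r := derivative ℂ (expSeries b)
  have h2 : derivative ℂ (2 : PowerSeries ℂ) = 0 := (derivative ℂ).map_natCast 2
  rw [sq] at hdW
  simp only [map_sub, Derivation.leibniz, smul_eq_mul, Derivation.map_one_eq_zero, h2] at hdP hdW
  -- Doubling and inserting 2W = P² - 1 turns the left side into 2P(rP)', which vanishes because rP
  -- = 1.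
  have h : derivative ℂ (r * W) + derivative ℂ r * W + derivative ℂ r = 0 := by
    rw [Derivation.leibniz, smul_eq_mul, smul_eq_mul]
    have h2 : (2 : PowerSeries ℂ) ≠ 0 := fun h => by
      have := congrArg constantCoeff h
      rw [map_ofNat, map_zero] at this
      exact two_ne_zero this
    refine mul_left_cancel₀ h2 ?_
    linear_combination r * hdW + 2 * derivative ℂ r * hW + 2 * P * hdP
  rw [h]
  simp [egfCoeff]

end FeynmanRules

/-! ### The tree sums -/

section TreeSums

open PowerSeries

variable {α : Type*} [DecidableEq α]

/-- The vertex rule of the vertex `S` with children `K`, times the propagator of the edge `S`. -/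
noncomputable def vertexFactor (m : ℝ) (a : ℕ → ℂ) (x : Finset α → ℝ) (S : Finset α)
    (K : Finset (Finset α)) : ℂ :=
  vertexRule m a (K.card + 1) (x S + ∑ C ∈ K, x C) * propagator (x S)

/-- Sums over subsets weighted by a quadratic form. -/
theorem sum_powerset_quadratic (g : α → α → ℂ) (b : ℕ → ℂ) (B : PowerSeries ℂ) (S : Finset α) :
    ∑ R ∈ S.powerset, (∑ i ∈ R, ∑ j ∈ R, g i j) * (b R.card * egfCoeff B (S \ R).card) =
      ∑ i ∈ S, ∑ j ∈ S, g i j *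
        if i = j then egfCoeff (derivative ℂ (expSeries b) * B) (S.card - 1)
        else egfCoeff (derivative ℂ (derivative ℂ (expSeries b)) * B) (S.card - 2) := by
  have h : ∀ R ∈ S.powerset, (∑ i ∈ R, ∑ j ∈ R, g i j) * (b R.card * egfCoeff B (S \ R).card) =
      ∑ i ∈ S, ∑ j ∈ S, g i j * ((if {i, j} ⊆ R then 1 else 0) * egfCoeff (expSeries b) R.card *
        egfCoeff B (S \ R).card) := by
    intro R hR
    have hRS := Finset.mem_powerset.1 hR
    rw [egfCoeff_expSeries, Finset.sum_mul, ← Finset.sum_subset hRS]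
    · refine Finset.sum_congr rfl fun i hi => ?_
      rw [Finset.sum_mul, ← Finset.sum_subset hRS]
      · refine Finset.sum_congr rfl fun j hj => ?_
        rw [if_pos (by simp [Finset.insert_subset_iff, hi, hj]), one_mul]
      · intro j _ hj
        simp [Finset.insert_subset_iff, hj]
    · intro i _ hi
      refine Finset.sum_eq_zero fun j _ => ?_
      simp [Finset.insert_subset_iff, hi]
  rw [Finset.sum_congr rfl h, Finset.sum_comm]
  refine Finset.sum_congr rfl fun i hi => ?_
  rw [Finset.sum_comm]
  refine Finset.sum_congr rfl fun j hj => ?_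
  have hK : {i, j} ⊆ S := by simp [Finset.insert_subset_iff, hi, hj]
  rw [← Finset.mul_sum]
  congr 1
  split_ifs with hij
  · subst hij
    have hc : ({i, i} : Finset α).card = 1 := by simp
    rw [sum_powerset_superset (expSeries b) (derivative ℂ (expSeries b)) B hK
      (fun n => by rw [egfCoeff_derivative, hc]), Finset.card_sdiff_of_subset hK, hc]
  · have hc : ({i, j} : Finset α).card = 2 := Finset.card_pair hij
    rw [sum_powerset_superset (expSeries b) (derivative ℂ (derivative ℂ (expSeries b))) B hK
      (fun n => by rw [egfCoeff_derivative, egfCoeff_derivative, hc]),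
      Finset.card_sdiff_of_subset hK, hc]

/-- The sum of all trees with top vertex at `S`, amputated at `S`, provided that the sums over
trees on proper subsets are given by `b`. -/
theorem sum_amputated {m : ℝ} {a b : ℕ → ℂ} (ha : a 0 = 1) (hb : IsInverseDiffeo a b)
    {g : α → α → ℝ} (hg : ∀ i, g i i = m ^ 2) {x : Finset α → ℝ}
    (hx : ∀ R, x R = ∑ i ∈ R, ∑ j ∈ R, g i j - m ^ 2)
    (v : Finset α → Finset (Finset α) → ℂ) {S : Finset α} (hS : 2 ≤ S.card)
    (hJ : ∀ R ⊂ S, R.Nonempty → ∑ T ∈ trees R, forestWeight v T = b R.card) :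
    ∑ F ∈ (forests S).filter (fun F => S ∉ F),
      vertexRule m a ((roots F).card + 1) (x S + ∑ C ∈ roots F, x C) * forestWeight v F =
        -Complex.I * (x S : ℂ) * b S.card := by
  have hne : S.Nonempty := Finset.card_pos.1 (by omega)
  let y : Finset α → ℂ := fun R => ∑ i ∈ R, ∑ j ∈ R, (g i j : ℂ)
  have hxy : ∀ R, (x R : ℂ) = y R - (m : ℂ) ^ 2 := fun R => by
    rw [hx]
    push_cast
    rfl
  let f : ℕ → ℂ := fun k => fCoeff a (k + 1)
  have hf1 : f 1 = 0 := fCoeff_two a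
  have hl1 : vertexC a 1 = 0 := by simp [vertexC]
  -- Forests containing `S` have one root, where both weights vanish, so the sum extends to all
  -- forests. For the others, the m² in the k + 1 offshell variables cancels against the multiple of
  -- f in `gCoeff`.
  have hterm : ∀ F ∈ forests S,
      (if S ∉ F then vertexRule m a ((roots F).card + 1) (x S + ∑ C ∈ roots F, x C) *
        forestWeight v F else 0) =
      Complex.I * (y S * (f (roots F).card * forestWeight v F) +
        f (roots F).card * (∑ R ∈ roots F, y R) * forestWeight v F -
        (m : ℂ) ^ 2 * (vertexC a (roots F).card * forestWeight v F)) := by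
    intro F hF
    by_cases hSF : S ∈ F
    · rw [if_neg (not_not.2 hSF), (card_roots_eq_one_iff hF).2 hSF, hf1, hl1]
      ring
    · have hk : (roots F).card ≠ 1 := fun h => hSF ((card_roots_eq_one_iff hF).1 h)
      rw [if_pos hSF, vertexRule, gCoeff, vertexC, if_neg hk]
      push_cast
      simp only [hxy, Finset.sum_sub_distrib, Finset.sum_const, nsmul_eq_mul, f]
      ring
  have hroots : ∑ F ∈ forests S, f (roots F).card * (∑ R ∈ roots F, y R) * forestWeight v F =
      ∑ R ∈ S.powerset, y R * (b R.card *
        egfCoeff ((expSeries fun k => f (k + 1)).subst (expSeries b)) (S \ R).card) := by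
    rw [sum_forests_sum_roots]
    refine Finset.sum_congr rfl fun R hR => ?_
    rcases R.eq_empty_or_nonempty with rfl | hRne
    · simp [y]
    · rw [mul_assoc, treeSum_mul_forestSum v hb.zero hf1 hJ (Finset.mem_powerset.1 hR) hRne]
  have hΦf := forestSum_eq_egfCoeff_subst_of_ssubset v hb.zero hne hf1 hJ
  have hΦl := forestSum_eq_egfCoeff_subst_of_ssubset v hb.zero hne hl1 hJ
  rw [forestSum] at hΦf hΦl
  rw [Finset.sum_filter, Finset.sum_congr rfl hterm, ← Finset.mul_sum, Finset.sum_sub_distrib,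
    Finset.sum_add_distrib, ← Finset.mul_sum, ← Finset.mul_sum, hΦf, hΦl, hroots,
    sum_powerset_quadratic, hxy]
  obtain ⟨n, hn⟩ : ∃ n, S.card = n + 2 := ⟨S.card - 2, by omega⟩
  have hon := onshell_identity ha hb (n := S.card) (by omega)
  have hoff := offshell_identity ha hb n
  -- The chain rule identifies the coefficient of the diagonal terms with that of F∘ρ, called `Φ`
  -- below.
  have hsucc := egfCoeff_subst_succ hb.zero f (n + 1)
  rw [← hn] at hoff
  rw [show n + 1 + 1 = S.card from hn.symm, show n + 1 = S.card - 1 by omega] at hsucc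
  rw [show n = S.card - 2 by omega] at hoff
  rw [← hsucc]
  set Φ := egfCoeff ((expSeries f).subst (expSeries b)) S.card
  -- For each `i`, the terms with `j ≠ i` cancel by the offshell identity; only `g i i = m ^ 2`
  -- survives.
  have hbracket : y S * (Φ + b S.card) + (∑ i ∈ S, ∑ j ∈ S, (g i j : ℂ) *
      if i = j then Φ else egfCoeff (derivative ℂ (derivative ℂ (expSeries b)) *
        (expSeries fun k => f (k + 1)).subst (expSeries b)) (S.card - 2)) =
      (m : ℂ) ^ 2 * (S.card * (2 * Φ + b S.card)) := by
    rw [Finset.sum_mul, ← Finset.sum_add_distrib]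
    have : ∀ i ∈ S, ((∑ j ∈ S, (g i j : ℂ)) * (Φ + b S.card) + ∑ j ∈ S, (g i j : ℂ) *
        if i = j then Φ else egfCoeff (derivative ℂ (derivative ℂ (expSeries b)) *
          (expSeries fun k => f (k + 1)).subst (expSeries b)) (S.card - 2)) =
        (m : ℂ) ^ 2 * (2 * Φ + b S.card) := by
      intro i hi
      rw [Finset.sum_mul, ← Finset.sum_add_distrib, Finset.sum_eq_single_of_mem i hi]
      · rw [if_pos rfl, hg]
        push_cast
        ring
      · intro j _ hji
        rw [if_neg hji.symm]
        linear_combination (g i j : ℂ) * hoff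
    rw [Finset.sum_congr rfl this, Finset.sum_const, nsmul_eq_mul]
    ring
  linear_combination Complex.I * hbracket + Complex.I * (m : ℂ) ^ 2 * hon

/-- The sum over all trees, including the propagator of the top edge, is the coefficient of the
inverse diffeomorphism. -/
theorem sum_trees_forestWeight {m : ℝ} {a b : ℕ → ℂ} (ha : a 0 = 1) (hb : IsInverseDiffeo a b)
    {g : α → α → ℝ} (hg : ∀ i, g i i = m ^ 2) {x : Finset α → ℝ}
    (hx : ∀ R, x R = ∑ i ∈ R, ∑ j ∈ R, g i j - m ^ 2) (S : Finset α) (hS : S.Nonempty)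
    (hne : ∀ R ⊆ S, 2 ≤ R.card → x R ≠ 0) :
    ∑ T ∈ trees S, forestWeight (vertexFactor m a x) T = b S.card := by
  induction S using Finset.strongInduction with
  | H S ih =>
    rcases Nat.lt_or_ge S.card 2 with hc | hc
    · have hc1 : S.card = 1 := by
        have := Finset.card_pos.2 hS
        omega
      obtain ⟨j, rfl⟩ := Finset.card_eq_one.1 hc1
      simp [trees_singleton, forestWeight, Finset.filter_singleton, inverse_coeff_one ha hb]
    · have hJ : ∀ R ⊂ S, R.Nonempty →
          ∑ T ∈ trees R, forestWeight (vertexFactor m a x) T = b R.card :=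
        fun R hR hRne => ih R hR hRne fun Q hQ => hne Q (hQ.trans hR.1)
      have hA := sum_amputated ha hb hg hx (vertexFactor m a x) hc hJ
      have hterm : ∀ F ∈ (forests S).filter (fun F => S ∉ F),
          forestWeight (vertexFactor m a x) (insert S F) = propagator (x S) *
            (vertexRule m a ((roots F).card + 1) (x S + ∑ C ∈ roots F, x C) *
              forestWeight (vertexFactor m a x) F) := by
        intro F hF
        obtain ⟨hF, hSF⟩ := Finset.mem_filter.1 hF
        rw [forestWeight_insert _ hF hSF hc, vertexFactor]
        ring
      have hxS : (x S : ℂ) ≠ 0 := Complex.ofReal_ne_zero.2 (hne S subset_rfl hc)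
      rw [sum_trees_eq hc, Finset.sum_congr rfl hterm, ← Finset.mul_sum, hA, propagator]
      field_simp
      rw [Complex.I_sq]
      ring

end TreeSums

/-! ### Amplitudes of Feynman trees -/

section Amplitudes

theorem feynmanTrees_eq_trees (n : ℕ) : feynmanTrees n = trees Finset.univ := by
  ext T
  simp only [feynmanTrees, mem_trees, mem_forests, Finset.mem_filter, Finset.mem_univ, true_and,
    Finset.subset_univ, implies_true, true_imp_iff]
  tauto

theorem edgesAt_eq_insert_children {n : ℕ} (T : Finset (Finset (Fin n))) (S : Finset (Fin n)) :
    edgesAt T S = insert S (children T S) := by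
  ext C
  simp only [edgesAt, children, Finset.mem_insert, Finset.mem_filter]

theorem self_notMem_children {α : Type*} [DecidableEq α] (T : Finset (Finset α)) (S : Finset α) :
    S ∉ children T S := by
  simp [children]

/-- Every vertex but the top one is paired with the internal edge above it; the edge above the top
vertex is external and has no propagator. -/
theorem treeAmplitude_insert {d n : ℕ} (m : ℝ) (a : ℕ → ℂ) (p : Fin n → Momentum d) (hn : 2 ≤ n)
    {F : Finset (Finset (Fin n))} (hF : F ∈ forests Finset.univ) (hu : Finset.univ ∉ F) :
    treeAmplitude m a p (insert Finset.univ F) =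
      vertexRule m a ((roots F).card + 1)
        (edgeVar m p Finset.univ + ∑ C ∈ roots F, edgeVar m p C) *
        forestWeight (vertexFactor m a (edgeVar m p)) F := by
  have hc : 2 ≤ (Finset.univ : Finset (Fin n)).card := by simpa using hn
  have hV : treeVertices (insert Finset.univ F) =
      insert Finset.univ (F.filter fun S => 2 ≤ S.card) := by
    rw [treeVertices, Finset.filter_insert, if_pos hc]
  have hE : internalEdges (insert Finset.univ F) = F.filter fun S => 2 ≤ S.card := by
    ext S
    simp only [internalEdges, Finset.mem_filter, Finset.mem_insert]
    constructor
    · rintro ⟨h | h, h2, h3⟩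
      · exact absurd h h3
      · exact ⟨h, h2⟩
    · rintro ⟨h, h2⟩
      exact ⟨.inr h, h2, fun h' => hu (h' ▸ h)⟩
  have hterm : ∀ S ∈ F.filter (fun S => 2 ≤ S.card),
      vertexRule m a (edgesAt (insert Finset.univ F) S).card
        (∑ C ∈ edgesAt (insert Finset.univ F) S, edgeVar m p C) =
      vertexRule m a ((children F S).card + 1)
        (edgeVar m p S + ∑ C ∈ children F S, edgeVar m p C) := by
    intro S hS
    rw [edgesAt_eq_insert_children, children_insert_of_mem hF (Finset.mem_filter.1 hS).1,
      Finset.card_insert_of_notMem (self_notMem_children _ _),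
      Finset.sum_insert (self_notMem_children _ _)]
  rw [treeAmplitude, hV, hE, Finset.prod_insert (by simp [hu]), Finset.prod_congr rfl hterm,
    edgesAt_eq_insert_children, Finset.card_insert_of_notMem (self_notMem_children _ _),
    Finset.sum_insert (self_notMem_children _ _), children_insert_self hF hu, mul_assoc,
    ← Finset.prod_mul_distrib]
  rfl

/-- The Minkowski product of two momenta. -/
def minkowskiDot {d : ℕ} (p q : Momentum d) : ℝ :=
  p 0 * q 0 - ∑ i : Fin d, p i.succ * q i.succ

theorem minkowskiDot_self {d : ℕ} (p : Momentum d) : minkowskiDot p p = minkowskiSq p := by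
  simp [minkowskiDot, minkowskiSq, sq]

theorem minkowskiSq_sum {d : ℕ} {ι : Type*} (p : ι → Momentum d) (R : Finset ι) :
    minkowskiSq (∑ j ∈ R, p j) = ∑ i ∈ R, ∑ j ∈ R, minkowskiDot (p i) (p j) := by
  simp only [minkowskiSq, minkowskiDot, Finset.sum_apply, Finset.sum_sub_distrib, sq,
    Finset.sum_mul_sum]
  congr 1
  rw [Finset.sum_comm]
  exact Finset.sum_congr rfl fun i _ => Finset.sum_comm

end Amplitudes

end FieldDiffeo

theorem mainTheorem8 (d : ℕ) (m : ℝ) (hm : 0 ≤ m) (a : ℕ → ℂ) (ha : a 0 = 1) (b : ℕ → ℂ)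
    (hb : FieldDiffeo.IsInverseDiffeo a b) :
    b 1 = 1 ∧
    ∀ n : ℕ, 2 ≤ n → ∀ p : Fin n → FieldDiffeo.Momentum d,
      (∀ j, FieldDiffeo.offshell m (p j) = 0) →
      (∀ S : Finset (Fin n), 2 ≤ S.card → S ≠ Finset.univ → FieldDiffeo.edgeVar m p S ≠ 0) →
      FieldDiffeo.amputatedTreeSum m a p =
          -Complex.I * (FieldDiffeo.edgeVar m p Finset.univ : ℂ) * b n ∧
        (FieldDiffeo.edgeVar m p Finset.univ ≠ 0 → FieldDiffeo.treeSum m a p = b n) := by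
  refine ⟨FieldDiffeo.inverse_coeff_one ha hb, fun n hn p hp hne => ?_⟩
  have hg : ∀ i, FieldDiffeo.minkowskiDot (p i) (p i) = m ^ 2 := fun i => by
    rw [FieldDiffeo.minkowskiDot_self]
    exact sub_eq_zero.1 (hp i)
  have hx : ∀ R, FieldDiffeo.edgeVar m p R =
      ∑ i ∈ R, ∑ j ∈ R, FieldDiffeo.minkowskiDot (p i) (p j) - m ^ 2 := fun R => by
    rw [FieldDiffeo.edgeVar, FieldDiffeo.offshell, FieldDiffeo.minkowskiSq_sum]
  have hc : 2 ≤ (Finset.univ : Finset (Fin n)).card := by simpa using hn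
  have hA : FieldDiffeo.amputatedTreeSum m a p =
      -Complex.I * (FieldDiffeo.edgeVar m p Finset.univ : ℂ) * b n := by
    -- Subtrees below the top vertex live on proper subsets, where the offshell variables are
    -- nonzero; the one of the top edge is never inverted here.
    have h := FieldDiffeo.sum_amputated ha hb hg hx
      (FieldDiffeo.vertexFactor m a (FieldDiffeo.edgeVar m p)) hc fun R hR hRne =>
        FieldDiffeo.sum_trees_forestWeight ha hb hg hx R hRne fun Q hQ hQc =>
          hne Q hQc (hR.trans_le' hQ).ne
    rw [Finset.card_univ, Fintype.card_fin] at h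
    rw [← h, FieldDiffeo.amputatedTreeSum, FieldDiffeo.feynmanTrees_eq_trees,
      FieldDiffeo.sum_trees_eq hc]
    refine Finset.sum_congr rfl fun F hF => ?_
    obtain ⟨hF, hu⟩ := Finset.mem_filter.1 hF
    exact FieldDiffeo.treeAmplitude_insert m a p hn hF hu
  refine ⟨hA, fun h0 => ?_⟩
  have h0 : (FieldDiffeo.edgeVar m p Finset.univ : ℂ) ≠ 0 := Complex.ofReal_ne_zero.2 h0
  rw [FieldDiffeo.treeSum, hA, FieldDiffeo.propagator]
  field_simp
  rw [Complex.I_sq]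
  ring
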